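/- Let $\chi_{-3}$ be the quadratic Dirichlet character attached to $\mathbb{Q}(\sqrt{-3})$, that is, the character modulo $3$ with $\chi_{-3}(n)=0,1,-1$ for $n\equiv 0,1,2 \pmod 3$ respectively; let $L(\chi_{-3},s)=\sum_{n\ge 1}\chi_{-3}(n)n^{-s}$, and let $d_3=\frac{3\sqrt{3}}{4\pi}L(\chi_{-3},2)$. Write $\sum'_{m,k}$ for the sum over all pairs $(m,k)\in\mathbb{Z}^2$ with $(m,k)\neq(0,0)$. Then the following double series converges absolutely, and $$\frac{6\sqrt{15}}{\pi^3}\sum'_{m,k}\left[\frac{1}{(m^2+15k^2)^2}-\frac{1}{(3m^2+5k^2)^2}+\frac{1}{(2m^2+mk+2k^2)^2}-\frac{1}{(m^2+mk+4k^2)^2}\right]=\frac{8}{5}\,d_3 .$$ -/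

import Mathlib

/-- The quadratic Dirichlet character attached to `ℚ(√-3)`, i.e. the Kronecker symbol `(-3 / ·)`:
by quadratic reciprocity it is the quadratic character modulo `3`, with values `0, 1, -1` at
`0, 1, 2` modulo `3`. -/
def chiNegThree : DirichletCharacter ℂ 3 :=
  (quadraticChar (ZMod 3)).ringHomComp (Int.castRingHom ℂ)

/-- `d₃ = (3√3 / 4π) · L(χ₋₃, 2)`, where `L(χ₋₃, s) = ∑_{n ≥ 1} χ₋₃(n) n^{-s}`. -/
noncomputable def dThree : ℂ :=
  ((3 * Real.sqrt 3 / (4 * Real.pi) : ℝ) : ℂ) * LSeries (fun n : ℕ => chiNegThree (n : ZMod 3)) 2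

/-- The general term of the double series, at `(m, k)`. -/
noncomputable def dirichletTerm (m k : ℤ) : ℝ :=
  1 / ((m : ℝ) ^ 2 + 15 * (k : ℝ) ^ 2) ^ 2
    - 1 / (3 * (m : ℝ) ^ 2 + 5 * (k : ℝ) ^ 2) ^ 2
    + 1 / (2 * (m : ℝ) ^ 2 + (m : ℝ) * (k : ℝ) + 2 * (k : ℝ) ^ 2) ^ 2
    - 1 / ((m : ℝ) ^ 2 + (m : ℝ) * (k : ℝ) + 4 * (k : ℝ) ^ 2) ^ 2

/-!
Let `P₁ = m² + mk + 4k²` and `P₂ = 2m² + mk + 2k²` be the two reduced forms of discriminant `-15`,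
with representation numbers `r₁` and `r₂`. The form `P₁` is the norm `N(a + bω)` of the order `ℤ[ω]`,
`ω² = ω - 4`, and `P₂` is half the norm on the nonprincipal ideal `(2, ω)`.

*Reduction to discriminant `-15`.* The forms `m² + 15k²` and `3m² + 5k²` are the restrictions of `P₁`
and `P₂` to sublattices of index two, so their representation numbers at `n` are `r₁(n)`, `r₂(n)` for
odd `n` and `r₁(n / 4)`, `r₂(n / 4)` for even `n`, where functions on `ℕ` are understood to vanish
at fractions. With `f = r₁ - r₂` and the Hecke relation
`f(2m) = -2 f(m) - f(m / 2)`, the double series becomes `(5 / 8) ∑ f(n) / n²`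
(`repCount_combination`).

*The coefficients `f`.* They satisfy
`f(pn) + χ₋₃(p) χ₅(p) f(n / p) = (χ₋₃(p) + χ₅(p)) f(n)` for every prime `p` (`hecke_formDiff`), hence
`f = 2 (χ₋₃ * χ₅)` (`formDiff_eq_genusConv`). The relation is proved by counting. If `p` is a norm,
the elements of norm `pn` are distributed among the two conjugate primes above `p`, the multiples of
`p` being common to both, and division by a generator identifies each part with the elements of norm
`n`; if instead `2p` is a norm, the quotients are representations of `n` by `P₂`. This treats `P₁`;
the relation at `2` exchanges `r₁` and `r₂` and Hecke operators commute, which gives the relation for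
`f` (`hecke_sub_of_hecke_principalForm`). That a prime `p` which is not inert has `p` or `2p` as a norm
is Fermat descent (`dvd_and_dvd_or_exists_principalForm_eq`), and quadratic reciprocity tells which
primes are inert.

*Conclusion.* So `∑ f(n) / n² = 2 L(χ₋₃, 2) L(χ₅, 2)`, and `L(χ₅, 2) = 4π² / (25√5)` follows from the
Fourier series of the second Bernoulli polynomial at `1 / 5` and `2 / 5`.
-/

/-! ### Representation numbers and Hecke operators -/

/-- The reduced form `m² + mk + 4k²` of the principal class of discriminant `-15`. -/
def principalForm (m k : ℤ) : ℤ := m ^ 2 + m * k + 4 * k ^ 2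

/-- The reduced form `2m² + mk + 2k²` of the other class of discriminant `-15`. -/
def nonprincipalForm (m k : ℤ) : ℤ := 2 * m ^ 2 + m * k + 2 * k ^ 2

/-- The number of representations of `n` by `P`, as an integer; it is `0` if that number is
infinite, which does not occur for definite forms. -/
noncomputable def repCount (P : ℤ → ℤ → ℤ) (n : ℕ) : ℤ :=
  ({z : ℤ × ℤ | P z.1 z.2 = n}.ncard : ℤ)

theorem finite_of_sq_add_sq_le {P : ℤ → ℤ → ℤ} (hP : ∀ m k, m ^ 2 + k ^ 2 ≤ 2 * P m k) (n : ℤ) :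
    {z : ℤ × ℤ | P z.1 z.2 = n}.Finite := by
  refine (Set.finite_Icc ((-(2 * n), -(2 * n)) : ℤ × ℤ) (2 * n, 2 * n)).subset ?_
  rintro ⟨a, b⟩ h
  simp only [Set.mem_ofPred_eq] at h
  have h1 := hP a b
  rw [h] at h1
  have ha := Int.le_self_sq a
  have ha' := Int.le_self_sq (-a)
  have hb := Int.le_self_sq b
  have hb' := Int.le_self_sq (-b)
  simp only [Set.mem_Icc, Prod.mk_le_mk]
  refine ⟨⟨?_, ?_⟩, ?_, ?_⟩ <;> nlinarith [sq_nonneg a, sq_nonneg b]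

theorem sq_add_sq_le_principalForm (m k : ℤ) : m ^ 2 + k ^ 2 ≤ 2 * principalForm m k := by
  unfold principalForm; nlinarith [sq_nonneg (m + k), sq_nonneg k]

theorem sq_add_sq_le_nonprincipalForm (m k : ℤ) : m ^ 2 + k ^ 2 ≤ 2 * nonprincipalForm m k := by
  unfold nonprincipalForm; nlinarith [sq_nonneg (m + k), sq_nonneg k, sq_nonneg m]

theorem principalForm_conj (m k : ℤ) : principalForm (m + k) (-k) = principalForm m k := by
  unfold principalForm; ring

/-- `heckeTail p r n` is `r (n / p)`, understood as `0` if `p` does not divide `n`. -/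
def heckeTail (p : ℕ) (r : ℕ → ℤ) (n : ℕ) : ℤ := if p ∣ n then r (n / p) else 0

/-- The Hecke operator `r ↦ (n ↦ r (p n) + ε r (n / p))` of weight one and nebentypus value `ε`. -/
def hecke (ε : ℤ) (p : ℕ) (r : ℕ → ℤ) (n : ℕ) : ℤ := r (p * n) + ε * heckeTail p r n

theorem heckeTail_mul (p : ℕ) (hp : 0 < p) (r : ℕ → ℤ) (n : ℕ) : heckeTail p r (p * n) = r n := by
  simp [heckeTail, Nat.mul_div_cancel_left n hp]

theorem heckeTail_mul_of_coprime {p q : ℕ} (h : p.Coprime q) (r : ℕ → ℤ) (n : ℕ) :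
    heckeTail p r (q * n) = heckeTail p (fun m => r (q * m)) n := by
  unfold heckeTail
  by_cases hn : p ∣ n
  · rw [if_pos hn, if_pos (hn.mul_left q), Nat.mul_div_assoc q hn]
  · rw [if_neg hn, if_neg fun h' => hn (h.dvd_of_dvd_mul_left h')]

theorem heckeTail_comm {p q : ℕ} (hp : 0 < p) (h : p.Coprime q) (r : ℕ → ℤ) (n : ℕ) :
    heckeTail p (heckeTail q r) n = heckeTail q (heckeTail p r) n := by
  by_cases hpn : p ∣ n
  · obtain ⟨m, rfl⟩ := hpn
    rw [heckeTail_mul p hp, heckeTail_mul_of_coprime h.symm]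
    simp only [heckeTail_mul p hp]
  · unfold heckeTail
    rw [if_neg hpn]
    split_ifs with h1 h2
    · exact absurd (h2.trans (Nat.div_dvd_of_dvd h1)) hpn
    · rfl
    · rfl

theorem hecke_comm {p q : ℕ} (hp : 0 < p) (h : p.Coprime q) (ε δ : ℤ) (r : ℕ → ℤ) :
    hecke ε p (hecke δ q r) = hecke δ q (hecke ε p r) := by
  have key : ∀ (p q : ℕ) (δ : ℤ), p.Coprime q → ∀ n, heckeTail p (hecke δ q r) n =
      heckeTail p r (q * n) + δ * heckeTail p (heckeTail q r) n := by
    intro p q δ h n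
    rw [heckeTail_mul_of_coprime h]
    by_cases hn : p ∣ n <;> simp [heckeTail, hecke, hn]
  funext n
  simp only [hecke] at key ⊢
  rw [key p q δ h, key q p ε h.symm, heckeTail_comm hp h, mul_left_comm p q n]
  ring

/-- In the order `ℤ[ω]` of discriminant `-15`, with `z = a + bω` and `π = X + yω`, the number
`p ∣ N π` divides the norm of `z` iff it divides the `ω`-coordinate of `z π̄` or of `z π`. -/
theorem dvd_or_dvd_of_dvd_principalForm {p : ℤ} (hp : Prime p) {X y a b : ℤ}
    (hX : p ∣ principalForm X y) (hz : p ∣ principalForm a b) :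
    p ∣ X * b - y * a ∨ p ∣ X * (-b) - y * (a + b) := by
  have h : p ∣ (X * b - y * a) * (X * (-b) - y * (a + b)) := by
    have : (X * b - y * a) * (X * (-b) - y * (a + b)) =
        y ^ 2 * principalForm a b - b ^ 2 * principalForm X y := by
      unfold principalForm; ring
    rw [this]
    exact dvd_sub (hz.mul_left _) (hX.mul_left _)
  exact hp.dvd_or_dvd h

/-- The representations `a + bω` of `n` by the principal form that lie in the prime ideal above `p`
which contains `X + yω`. -/
def repsAbove (p X y : ℤ) (n : ℕ) : Set (ℤ × ℤ) :=
  {z | principalForm z.1 z.2 = n ∧ p ∣ X * z.2 - y * z.1}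

/-- Multiples of `p` count the representations lying above both primes over `p`. -/
theorem ncard_smul_reps (P : ℤ → ℤ → ℤ) (hP : ∀ c m k, P (c * m) (c * k) = c ^ 2 * P m k)
    {p : ℕ} (hp : 0 < p) (n : ℕ) :
    (({z : ℤ × ℤ | P z.1 z.2 = (p * n : ℕ) ∧ (p : ℤ) ∣ z.1 ∧ (p : ℤ) ∣ z.2}.ncard : ℕ) : ℤ) =
      heckeTail p (repCount P) n := by
  have hp0 : (p : ℤ) ≠ 0 := by positivity
  unfold heckeTail repCount
  split_ifs with h
  · obtain ⟨m, rfl⟩ := h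
    rw [Nat.mul_div_cancel_left m hp]
    congr 1
    symm
    refine Set.ncard_congr (fun z _ => ((p : ℤ) * z.1, (p : ℤ) * z.2)) ?_ ?_ ?_
    · rintro ⟨a, b⟩ hz
      simp only [Set.mem_ofPred_eq] at hz ⊢
      refine ⟨?_, by simp, by simp⟩
      rw [hP, hz]; push_cast; ring
    · rintro ⟨a, b⟩ ⟨c, d⟩ _ _ h
      simpa [hp.ne'] using h
    · rintro ⟨a, b⟩ ⟨hz, ⟨c, rfl⟩, ⟨d, rfl⟩⟩
      refine ⟨(c, d), ?_, rfl⟩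
      simp only [Set.mem_ofPred_eq] at hz ⊢
      rw [hP] at hz
      push_cast at hz
      have : (p : ℤ) ^ 2 * P c d = p ^ 2 * m := by rw [hz]; ring
      exact mul_left_cancel₀ (pow_ne_zero 2 hp0) this
  · rw [Nat.cast_eq_zero]
    convert Set.ncard_empty (ℤ × ℤ)
    refine Set.eq_empty_iff_forall_notMem.2 ?_
    rintro ⟨a, b⟩ ⟨hz, ⟨c, rfl⟩, ⟨d, rfl⟩⟩
    simp only at hz
    rw [hP] at hz
    push_cast at hz
    have : (p : ℤ) * P c d = n := mul_left_cancel₀ hp0 (by rw [← hz]; ring)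
    exact h (Int.natCast_dvd_natCast.1 ⟨_, this.symm⟩)

theorem principalForm_mul (c m k : ℤ) :
    principalForm (c * m) (c * k) = c ^ 2 * principalForm m k := by
  unfold principalForm; ring

theorem nonprincipalForm_mul (c m k : ℤ) :
    nonprincipalForm (c * m) (c * k) = c ^ 2 * nonprincipalForm m k := by
  unfold nonprincipalForm; ring

/-- The representations of a multiple of an unramified prime `p` are divided among the two primes
above `p`, which complex conjugation exchanges. -/
theorem repCount_add_heckeTail_principalForm {p : ℕ} (hp : p.Prime) {X y : ℤ}
    (hX : (p : ℤ) ∣ principalForm X y) (hy : ¬ (p : ℤ) ∣ y) (hs : ¬ (p : ℤ) ∣ 2 * X + y) (n : ℕ) :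
    repCount principalForm (p * n) + heckeTail p (repCount principalForm) n =
      2 * (repsAbove p X y (p * n)).ncard := by
  have hp' : Prime (p : ℤ) := Nat.prime_iff_prime_int.1 hp
  set σ : ℤ × ℤ → ℤ × ℤ := fun z => (z.1 + z.2, -z.2) with hσ
  have hσσ : Function.Involutive σ := fun z => by simp [hσ]
  set U := repsAbove p X y (p * n) with hU
  have hfin : U.Finite :=
    (finite_of_sq_add_sq_le sq_add_sq_le_principalForm (p * n : ℕ)).subset fun z hz => hz.1
  have hV : σ '' U = {z | principalForm z.1 z.2 = (p * n : ℕ) ∧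
      (p : ℤ) ∣ X * (-z.2) - y * (z.1 + z.2)} := by
    rw [hσσ.image_eq_preimage_symm]
    ext ⟨a, b⟩
    simp [hU, repsAbove, hσ, principalForm_conj]
  have hunion : U ∪ σ '' U = {z | principalForm z.1 z.2 = (p * n : ℕ)} := by
    rw [hV]
    ext ⟨a, b⟩
    simp only [hU, repsAbove, Set.mem_union, Set.mem_ofPred_eq, ← and_or_left, and_iff_left_iff_imp]
    intro h
    exact dvd_or_dvd_of_dvd_principalForm hp' hX (h ▸ ⟨n, by push_cast; ring⟩)
  have hinter : U ∩ σ '' U = {z | principalForm z.1 z.2 = (p * n : ℕ) ∧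
      (p : ℤ) ∣ z.1 ∧ (p : ℤ) ∣ z.2} := by
    rw [hV]
    ext ⟨a, b⟩
    simp only [hU, repsAbove, Set.mem_inter_iff, Set.mem_ofPred_eq]
    constructor
    · rintro ⟨⟨h, h1⟩, -, h2⟩
      have hb : (p : ℤ) ∣ b := by
        refine (hp'.dvd_or_dvd (a := 2 * X + y) ?_).resolve_left hs
        have := dvd_sub h1 h2
        rwa [show X * b - y * a - (X * -b - y * (a + b)) = (2 * X + y) * b by ring] at this
      refine ⟨h, ?_, hb⟩
      have := dvd_sub (hb.mul_left X) h1
      rw [sub_sub_cancel] at this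
      exact (hp'.dvd_or_dvd this).resolve_left hy
    · rintro ⟨h, ha, hb⟩
      exact ⟨⟨h, dvd_sub (hb.mul_left _) (ha.mul_left _)⟩, h,
        dvd_sub ((dvd_neg.2 hb).mul_left _) ((dvd_add ha hb).mul_left _)⟩
  have := Set.ncard_union_add_ncard_inter U (σ '' U) hfin (hfin.image σ)
  rw [hunion, hinter, Set.ncard_image_of_injective U hσσ.injective] at this
  rw [← ncard_smul_reps principalForm principalForm_mul hp.pos n]
  unfold repCount
  exact_mod_cast (by omega)

/-- At a ramified prime there is only one prime above `p`. -/
theorem repCount_principalForm_of_dvd {p : ℕ} (hp : p.Prime) {X y : ℤ}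
    (hX : (p : ℤ) ∣ principalForm X y) (hs : (p : ℤ) ∣ 2 * X + y) (n : ℕ) :
    repCount principalForm (p * n) = (repsAbove p X y (p * n)).ncard := by
  unfold repCount repsAbove
  congr 2
  ext ⟨a, b⟩
  simp only [Set.mem_ofPred_eq]
  refine ⟨fun h => ⟨h, ?_⟩, fun h => h.1⟩
  rcases dvd_or_dvd_of_dvd_principalForm (Nat.prime_iff_prime_int.1 hp) hX
    (h ▸ ⟨n, by push_cast; ring⟩ : (p : ℤ) ∣ principalForm a b) with h1 | h1
  · exact h1
  · have := dvd_add h1 (hs.mul_right b)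
    rwa [show X * -b - y * (a + b) + (2 * X + y) * b = X * b - y * a by ring] at this

/-- If the prime above `p` is generated by `x + yω`, division by it maps the representations lying
above it to the representations of the quotient by the same form. -/
theorem ncard_repsAbove_of_principalForm {p : ℕ} (hp : p.Prime) {x y : ℤ}
    (h : principalForm x y = p) (hy : ¬ (p : ℤ) ∣ y) (n : ℕ) :
    ((repsAbove p x y (p * n)).ncard : ℤ) = repCount principalForm n := by
  have hp' : Prime (p : ℤ) := Nat.prime_iff_prime_int.1 hp
  unfold repCount
  congr 1
  symm
  refine Set.ncard_congr (fun z _ => (x * z.1 - 4 * y * z.2, x * z.2 + y * z.1 + y * z.2)) ?_ ?_ ?_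
  · rintro ⟨u, v⟩ hz
    simp only [Set.mem_ofPred_eq, repsAbove] at hz ⊢
    refine ⟨?_, v, ?_⟩
    · rw [Nat.cast_mul, ← h, ← hz]; unfold principalForm; ring
    · rw [← h]; unfold principalForm; ring
  · rintro ⟨u, v⟩ ⟨u', v'⟩ _ _ e
    simp only [Prod.mk.injEq] at e ⊢
    obtain ⟨e1, e2⟩ := e
    have hv : v = v' := by
      refine mul_left_cancel₀ hp'.ne_zero ?_
      rw [← h]; unfold principalForm
      linear_combination x * e2 - y * e1
    have hu : u = u' := by
      refine mul_left_cancel₀ hp'.ne_zero ?_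
      rw [← h]; unfold principalForm
      linear_combination (x + y) * e1 + 4 * y * e2
    exact ⟨hu, hv⟩
  · rintro ⟨a, b⟩ ⟨hz, v, hv⟩
    simp only at hz hv
    have hu : (p : ℤ) ∣ a * (x + y) + 4 * b * y := by
      refine (hp'.dvd_or_dvd (a := y) ⟨b - (x + y) * v, ?_⟩).resolve_left hy
      have : y * (a * (x + y) + 4 * b * y) = b * principalForm x y - (x + y) * (x * b - y * a) := by
        unfold principalForm; ring
      rw [this, h, hv]; ring
    obtain ⟨u, hu⟩ := hu
    have h1 : x * u - 4 * y * v = a := by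
      refine mul_left_cancel₀ hp'.ne_zero ?_
      have : (p : ℤ) * a = principalForm x y * a := by rw [h]
      rw [this]; unfold principalForm
      linear_combination 4 * y * hv - x * hu
    have h2 : x * v + y * u + y * v = b := by
      refine mul_left_cancel₀ hp'.ne_zero ?_
      have : (p : ℤ) * b = principalForm x y * b := by rw [h]
      rw [this]; unfold principalForm
      linear_combination - (x + y) * hv - y * hu
    refine ⟨(u, v), ?_, Prod.ext h1 h2⟩
    simp only [Set.mem_ofPred_eq]
    refine mul_left_cancel₀ hp'.ne_zero ?_
    rw [Nat.cast_mul] at hz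
    rw [← hz, ← h1, ← h2]
    nth_rw 1 [← h]
    unfold principalForm; ring

/-- If the prime above `p` is not principal, its product with the prime `(2, ω)` above `2` is
generated by `2x + yω`, and division maps the representations lying above it to representations of
the quotient by the other form. -/
theorem ncard_repsAbove_of_nonprincipalForm {p : ℕ} (hp : p.Prime) {x y : ℤ}
    (h : nonprincipalForm x y = p) (hy : ¬ (p : ℤ) ∣ y) (n : ℕ) :
    ((repsAbove p (2 * x) y (p * n)).ncard : ℤ) = repCount nonprincipalForm n := by
  have hp' : Prime (p : ℤ) := Nat.prime_iff_prime_int.1 hp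
  unfold repCount
  congr 1
  symm
  refine Set.ncard_congr
    (fun z _ => (2 * x * z.1 + 2 * y * z.2 + x * z.2, y * z.1 - x * z.2)) ?_ ?_ ?_
  · rintro ⟨u, v⟩ hz
    simp only [Set.mem_ofPred_eq, repsAbove] at hz ⊢
    refine ⟨?_, -v, ?_⟩
    · rw [Nat.cast_mul, ← h, ← hz]; unfold principalForm nonprincipalForm; ring
    · rw [← h]; unfold nonprincipalForm; ring
  · rintro ⟨u, v⟩ ⟨u', v'⟩ _ _ e
    simp only [Prod.mk.injEq] at e ⊢
    obtain ⟨e1, e2⟩ := e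
    have hv : v = v' := by
      refine mul_left_cancel₀ hp'.ne_zero ?_
      rw [← h]; unfold nonprincipalForm
      linear_combination y * e1 - 2 * x * e2
    have hu : u = u' := by
      refine mul_left_cancel₀ hp'.ne_zero ?_
      rw [← h]; unfold nonprincipalForm
      linear_combination x * e1 + (2 * y + x) * e2
    exact ⟨hu, hv⟩
  · rintro ⟨a, b⟩ ⟨hz, v, hv⟩
    simp only at hz hv
    have hu : (p : ℤ) ∣ x * a + (2 * y + x) * b := by
      refine (hp'.dvd_or_dvd (a := y) ⟨b - x * v, ?_⟩).resolve_left hy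
      have : y * (x * a + (2 * y + x) * b) =
          b * nonprincipalForm x y - x * (2 * x * b - y * a) := by
        unfold nonprincipalForm; ring
      rw [this, h, hv]; ring
    obtain ⟨u, hu⟩ := hu
    have h1 : 2 * x * u + 2 * y * (-v) + x * (-v) = a := by
      refine mul_left_cancel₀ hp'.ne_zero ?_
      have : (p : ℤ) * a = nonprincipalForm x y * a := by rw [h]
      rw [this]; unfold nonprincipalForm
      linear_combination (2 * y + x) * hv - 2 * x * hu
    have h2 : y * u - x * (-v) = b := by
      refine mul_left_cancel₀ hp'.ne_zero ?_
      have : (p : ℤ) * b = nonprincipalForm x y * b := by rw [h]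
      rw [this]; unfold nonprincipalForm
      linear_combination - x * hv - y * hu
    refine ⟨(u, -v), ?_, Prod.ext h1 h2⟩
    simp only [Set.mem_ofPred_eq]
    refine mul_left_cancel₀ hp'.ne_zero ?_
    rw [Nat.cast_mul] at hz
    rw [← hz, ← h1, ← h2]
    nth_rw 1 [← h]
    unfold principalForm nonprincipalForm; ring

theorem hecke_two_principalForm :
    hecke 1 2 (repCount principalForm) = fun n => 2 * repCount nonprincipalForm n := by
  funext n
  have h := repCount_add_heckeTail_principalForm (p := 2) Nat.prime_two (X := 2 * 0) (y := 1)
    (by decide) (by decide) (by decide) n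
  rw [ncard_repsAbove_of_nonprincipalForm Nat.prime_two (by decide) (by decide)] at h
  simpa [hecke] using h

theorem hecke_two_nonprincipalForm :
    hecke 1 2 (repCount nonprincipalForm) = fun n => 2 * repCount principalForm n := by
  funext n
  set U : Set (ℤ × ℤ) := {z | nonprincipalForm z.1 z.2 = (2 * n : ℕ) ∧ ((2 : ℕ) : ℤ) ∣ z.1} with hU
  have hfin : U.Finite :=
    (finite_of_sq_add_sq_le sq_add_sq_le_nonprincipalForm (2 * n : ℕ)).subset fun z hz => hz.1
  have hcard : (U.ncard : ℤ) = repCount principalForm n := by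
    unfold repCount
    congr 1
    symm
    refine Set.ncard_congr (fun z _ => (2 * z.2, z.1)) ?_ ?_ ?_
    · rintro ⟨u, v⟩ hz
      simp only [Set.mem_ofPred_eq, hU] at hz ⊢
      refine ⟨?_, by simp⟩
      push_cast; rw [← hz]; unfold principalForm nonprincipalForm; ring
    · rintro ⟨u, v⟩ ⟨u', v'⟩ _ _ e
      simp only [Prod.mk.injEq] at e ⊢
      omega
    · rintro ⟨a, b⟩ ⟨hz, v, rfl⟩
      refine ⟨(b, v), ?_, rfl⟩
      simp only [Set.mem_ofPred_eq, principalForm, nonprincipalForm] at hz ⊢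
      push_cast at hz
      linarith
  have hV : Prod.swap '' U = {z | nonprincipalForm z.1 z.2 = (2 * n : ℕ) ∧ ((2 : ℕ) : ℤ) ∣ z.2} := by
    rw [Set.image_swap_eq_preimage_swap]
    ext ⟨a, b⟩
    simp only [hU, Set.mem_preimage, Set.mem_ofPred_eq, Prod.swap_prod_mk, nonprincipalForm]
    rw [show 2 * b ^ 2 + b * a + 2 * a ^ 2 = 2 * a ^ 2 + a * b + 2 * b ^ 2 by ring]
  have hunion : U ∪ Prod.swap '' U = {z | nonprincipalForm z.1 z.2 = (2 * n : ℕ)} := by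
    rw [hV]
    ext ⟨a, b⟩
    simp only [hU, Set.mem_union, Set.mem_ofPred_eq, ← and_or_left, and_iff_left_iff_imp]
    intro h
    refine Int.prime_two.dvd_or_dvd ⟨n - a ^ 2 - b ^ 2, ?_⟩
    unfold nonprincipalForm at h
    push_cast at h
    linarith
  have hinter : U ∩ Prod.swap '' U = {z | nonprincipalForm z.1 z.2 = (2 * n : ℕ) ∧
      ((2 : ℕ) : ℤ) ∣ z.1 ∧ ((2 : ℕ) : ℤ) ∣ z.2} := by
    rw [hV]
    ext ⟨a, b⟩
    simp only [hU, Set.mem_inter_iff, Set.mem_ofPred_eq]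
    tauto
  have := Set.ncard_union_add_ncard_inter U (Prod.swap '' U) hfin (hfin.image _)
  rw [hunion, hinter, Set.ncard_image_of_injective U Prod.swap_injective] at this
  rw [hecke, ← ncard_smul_reps nonprincipalForm nonprincipalForm_mul two_pos n, ← hcard, one_mul]
  unfold repCount
  have := congrArg (Nat.cast : ℕ → ℤ) this
  rw [Nat.cast_add, Nat.cast_add] at this
  linarith

/-- Passing a Hecke relation from the principal form to the difference of the two forms, through
the Hecke operator at `2`, which exchanges the classes. -/
theorem hecke_sub_of_hecke_principalForm {p : ℕ} (hp : p.Prime) (hp2 : p ≠ 2) {ε α β : ℤ}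
    (h : hecke ε p (repCount principalForm) =
      fun n => α * repCount principalForm n + β * repCount nonprincipalForm n) (n : ℕ) :
    hecke ε p (fun m => repCount principalForm m - repCount nonprincipalForm m) n =
      (α - β) * (repCount principalForm n - repCount nonprincipalForm n) := by
  have hcop : p.Coprime 2 := (Nat.coprime_primes hp Nat.prime_two).2 hp2
  have hc := congrFun (hecke_comm hp.pos hcop ε 1 (repCount principalForm)) n
  rw [hecke_two_principalForm, h] at hc
  have h1 := congrFun hecke_two_principalForm n
  have h2 := congrFun hecke_two_nonprincipalForm n
  have h3 := congrFun h n
  simp only [hecke, heckeTail] at hc h1 h2 h3 ⊢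
  refine mul_left_cancel₀ (two_ne_zero (α := ℤ)) ?_
  split_ifs at hc h1 h2 h3 ⊢ <;> linear_combination 2 * h3 - hc - α * h1 - β * h2

/-! ### Descent: norms of primes -/

/-- The part of a representation `z = a + bω` prime to `p`: if `p` or `2p` is represented by
`X + yω`, then `z π̄ / p` or `z π / p` is integral. -/
theorem exists_principalForm_eq_div {p : ℤ} (hp : Prime p) {X y a b w m : ℤ}
    (hX : principalForm X y = w * p) (hy : ¬ p ∣ y) (hz : principalForm a b = p * m) :
    ∃ c d, principalForm c d = w * m := by
  -- conjugating `z` allows to assume that `z π̄` is the product divisible by `p`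
  wlog h : p ∣ X * b - y * a generalizing a b
  · refine this (a := a + b) (b := -b) (by rw [principalForm_conj, hz]) ?_
    exact (dvd_or_dvd_of_dvd_principalForm hp (hX ▸ dvd_mul_left _ _)
      (hz ▸ dvd_mul_right _ _)).resolve_left h
  obtain ⟨v, hv⟩ := h
  have hu : p ∣ a * (X + y) + 4 * b * y := by
    refine (hp.dvd_or_dvd (a := y) ⟨b * w - (X + y) * v, ?_⟩).resolve_left hy
    have : y * (a * (X + y) + 4 * b * y) = b * principalForm X y - (X + y) * (X * b - y * a) := by
      unfold principalForm; ring
    rw [this, hX, hv]; ring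
  obtain ⟨u, hu⟩ := hu
  refine ⟨u, v, mul_left_cancel₀ (pow_ne_zero 2 hp.ne_zero) ?_⟩
  have : p ^ 2 * principalForm u v = principalForm X y * principalForm a b := by
    rw [← principalForm_mul, ← hu, ← hv]; unfold principalForm; ring
  rw [this, hX, hz]; ring

/-- An element of norm `4m` is divisible by `2`, by `ω` or by `ω̄`, all of norm `4`. -/
theorem exists_principalForm_eq_of_four_dvd {a b m : ℤ} (h : principalForm a b = 4 * m) :
    ∃ c d, principalForm c d = m := by
  unfold principalForm at *
  rcases Int.even_or_odd' b with ⟨s, rfl | rfl⟩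
  · rcases Int.even_or_odd' a with ⟨t, rfl | rfl⟩
    · exact ⟨t, s, by linarith⟩
    · ring_nf at h; omega
  · -- `a (a + b)` is divisible by `4` and one factor is odd
    have h4 : (4 : ℤ) ∣ a * (a + (2 * s + 1)) :=
      ⟨m - (2 * s + 1) ^ 2, by linarith⟩
    rcases Int.even_or_odd' a with ⟨t, rfl | rfl⟩
    · have : IsCoprime (4 : ℤ) (2 * t + (2 * s + 1)) := by
        rw [show (4 : ℤ) = 2 ^ 2 by norm_num]
        exact IsCoprime.pow_left ⟨-(t + s), 1, by ring⟩
      obtain ⟨r, hr⟩ := this.dvd_of_dvd_mul_right h4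
      exact ⟨2 * s + 1, r, by rw [hr] at h; linarith⟩
    · have : IsCoprime (4 : ℤ) (2 * t + 1) := by
        rw [show (4 : ℤ) = 2 ^ 2 by norm_num]
        exact IsCoprime.pow_left ⟨-t, 1, by ring⟩
      obtain ⟨r, hr⟩ := this.dvd_of_dvd_mul_left h4
      have ha : 2 * t + 1 = 4 * r - (2 * s + 1) := by linarith
      exact ⟨-(2 * s + 1), r, by rw [ha] at h; linarith⟩

/-- If the odd prime `p` represented by `X + yω` divided `y`, its square would divide `w p`. -/
theorem not_dvd_of_principalForm_eq {p : ℤ} (hp : Prime p) {X y w : ℤ} (hw : ¬ p ∣ w)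
    (hX : principalForm X y = w * p) : ¬ p ∣ y := by
  rintro ⟨s, rfl⟩
  have hpX : p ∣ X := by
    refine hp.dvd_of_dvd_pow (n := 2) ⟨w - X * s - 4 * p * s ^ 2, ?_⟩
    unfold principalForm at hX
    linarith
  obtain ⟨t, rfl⟩ := hpX
  rw [principalForm_mul] at hX
  refine hw ⟨principalForm t s, mul_left_cancel₀ hp.ne_zero ?_⟩
  linear_combination -hX

theorem principalForm_pos {a b : ℤ} (h : ¬ (a = 0 ∧ b = 0)) : 0 < principalForm a b := by
  have := sq_add_sq_le_principalForm a b
  by_contra hn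
  exact h ⟨by nlinarith [sq_nonneg a, sq_nonneg b], by nlinarith [sq_nonneg a, sq_nonneg b]⟩

/-- Descent on the cofactor `c`: suppose that each odd prime `q < p` is inert or has `q` or `2q` as a
norm. If `p c` is a norm for some `c < p`, then so is `p` or `2p`: the odd prime factors of `c` and
the factors `4` can be divided out one at a time. -/
theorem exists_principalForm_eq_of_mul {p : ℕ} (hp : p.Prime)
    (ih : ∀ q < p, q.Prime → q ≠ 2 → ∀ a b : ℤ, (q : ℤ) ∣ principalForm a b →
      ((q : ℤ) ∣ a ∧ (q : ℤ) ∣ b) ∨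
        ∃ X y w : ℤ, (w = 1 ∨ w = 2) ∧ principalForm X y = w * q) :
    ∀ c : ℕ, 0 < c → c < p → ∀ a b : ℤ, principalForm a b = p * c →
      ∃ X y w : ℤ, (w = 1 ∨ w = 2) ∧ principalForm X y = w * p := by
  intro c
  induction c using Nat.strong_induction_on with
  | _ c IH =>
  intro hc hcp a b hab
  by_cases h4 : 4 ∣ c
  · obtain ⟨m, rfl⟩ := h4
    obtain ⟨s, t, hst⟩ := exists_principalForm_eq_of_four_dvd (m := p * m)
      (by rw [hab]; push_cast; ring)
    exact IH m (by omega) (by omega) (by omega) s t hst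
  by_cases hodd : ∃ q : ℕ, q.Prime ∧ q ≠ 2 ∧ q ∣ c
  · obtain ⟨q, hq, hq2, m, rfl⟩ := hodd
    have hq' : Prime (q : ℤ) := Nat.prime_iff_prime_int.1 hq
    have hq3 : 3 ≤ q := by have := hq.two_le; omega
    have hm : 0 < m := Nat.pos_of_mul_pos_left hc
    have hqp : q < p := lt_of_le_of_lt (Nat.le_mul_of_pos_right q hm) hcp
    have hz : principalForm a b = q * (p * m) := by rw [hab]; push_cast; ring
    rcases ih q hqp hq hq2 a b (hz ▸ dvd_mul_right _ _) with ⟨⟨s, rfl⟩, ⟨t, rfl⟩⟩ | ⟨X, y, w, hw, hX⟩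
    · rw [principalForm_mul] at hz
      have hz' : (q : ℤ) * principalForm s t = p * m :=
        mul_left_cancel₀ hq'.ne_zero (by rw [← hz]; ring)
      have hqm : q ∣ m := by
        have : (q : ℤ) ∣ (p * m : ℕ) := ⟨_, by push_cast; exact hz'.symm⟩
        refine ((hq.dvd_mul).1 (Int.natCast_dvd_natCast.1 this)).resolve_left fun h => ?_
        exact hqp.ne ((Nat.prime_dvd_prime_iff_eq hq hp).1 h)
      obtain ⟨l, rfl⟩ := hqm
      have hl : 0 < l := Nat.pos_of_mul_pos_left hm
      have hlt : l < q * (q * l) := by nlinarith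
      refine IH l hlt hl (hlt.trans hcp) s t (mul_left_cancel₀ hq'.ne_zero ?_)
      rw [hz']; push_cast; ring
    · have hy := not_dvd_of_principalForm_eq hq' (w := w) (fun h => ?_) hX
      · obtain ⟨s, t, hst⟩ := exists_principalForm_eq_div hq' hX hy hz
        rcases hw with rfl | rfl
        · have hlt : m < q * m := by nlinarith
          exact IH m hlt hm (hlt.trans hcp) s t (by rw [hst, one_mul])
        · have hlt : 2 * m < q * m := by nlinarith
          exact IH (2 * m) hlt (by omega) (hlt.trans hcp) s t (by rw [hst]; push_cast; ring)
      · rcases hw with rfl | rfl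
        · exact hq'.not_isUnit (isUnit_of_dvd_one h)
        · have := Int.le_of_dvd two_pos h
          omega
  · have hc2 : c = 1 ∨ c = 2 := by
      push Not at hodd
      have hk := Nat.eq_prime_pow_of_unique_prime_dvd (p := 2) hc.ne'
        fun {d} hd hdc => by by_contra h; exact hodd d hd h hdc
      generalize c.primeFactorsList.length = k at hk
      rcases k with - | - | k
      · exact Or.inl hk
      · exact Or.inr hk
      · exact absurd ⟨2 ^ k, by rw [hk]; ring⟩ h4
    refine ⟨a, b, c, ?_, by rw [hab, mul_comm]⟩
    rcases hc2 with rfl | rfl <;> simp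

/-- An odd prime `p` is inert in `ℤ[ω]` unless `p` or `2p` is a norm. This is the form in which the
class number two, with `(2, ω)` representing the nonprincipal class, enters the count. -/
theorem dvd_and_dvd_or_exists_principalForm_eq (p : ℕ) (hp : p.Prime) (hp2 : p ≠ 2) (a b : ℤ)
    (h : (p : ℤ) ∣ principalForm a b) : ((p : ℤ) ∣ a ∧ (p : ℤ) ∣ b) ∨
      ∃ X y w : ℤ, (w = 1 ∨ w = 2) ∧ principalForm X y = w * p := by
  induction p using Nat.strong_induction_on generalizing a b with
  | _ p IH =>
  have hp' : Prime (p : ℤ) := Nat.prime_iff_prime_int.1 hp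
  have hp3 : 3 ≤ p := by have := hp.two_le; omega
  by_cases hb : (p : ℤ) ∣ b
  · refine Or.inl ⟨hp'.dvd_of_dvd_pow (n := 2) ?_, hb⟩
    have e : a ^ 2 = principalForm a b - b * (a + 4 * b) := by unfold principalForm; ring
    rw [e]
    exact dvd_sub h (hb.mul_right _)
  right
  -- scale to `t + ω` with `|2t + 1| ≤ p`
  obtain ⟨u, v, huv⟩ : IsCoprime b (p : ℤ) := (hp'.coprime_iff_not_dvd.2 hb).symm
  set t := Int.bmod (a * u) p with ht
  have htd : (p : ℤ) ∣ a * u - t := by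
    rw [ht]; exact Int.dvd_self_sub_bmod
  have h1 : (p : ℤ) ∣ principalForm t 1 := by
    obtain ⟨s, hs⟩ := htd
    obtain ⟨k, hk⟩ := h
    have hts : t = a * u - p * s := by linarith
    have hbu : u * b = 1 - v * p := by linarith
    have e : principalForm (a * u) (b * u) = u ^ 2 * (p * k) := by
      rw [← hk]; unfold principalForm; ring
    rw [show b * u = 1 - v * p by linarith] at e
    refine ⟨u ^ 2 * k + (-s * (t + a * u) - s) + a * u * v + 4 * (2 * v - v ^ 2 * p), ?_⟩
    rw [hts]
    unfold principalForm at e ⊢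
    linear_combination e
  have hlo : -(p : ℤ) ≤ 2 * t := by
    have := Int.le_bmod (x := a * u) (m := p) (by omega); omega
  have hhi : 2 * t + 1 ≤ p := by
    have := Int.bmod_lt (x := a * u) (m := p) (by omega); omega
  obtain ⟨c, hc⟩ := h1
  have hpos := principalForm_pos (a := t) (b := 1) (by simp)
  rw [hc] at hpos
  have hc0 : 0 < c := pos_of_mul_pos_right hpos (by positivity)
  lift c to ℕ using hc0.le
  refine exists_principalForm_eq_of_mul hp (fun q hq hqp hq2 a b h => IH q hq hqp hq2 a b h) c
    (by exact_mod_cast hc0) ?_ t 1 hc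
  have hc' : 4 * ((p : ℤ) * c) = (2 * t + 1) ^ 2 + 15 := by
    rw [← hc]; unfold principalForm; ring
  have : (2 * t + 1) ^ 2 ≤ (p : ℤ) ^ 2 := sq_le_sq' (by linarith) hhi
  by_contra hcp
  have hcp' : (p : ℤ) ≤ c := by exact_mod_cast not_lt.1 hcp
  have hp3' : (3 : ℤ) ≤ p := by exact_mod_cast hp3
  nlinarith

/-! ### The theta coefficients are a Dirichlet convolution -/

instance fact_prime_five : Fact (Nat.Prime 5) := ⟨Nat.prime_five⟩

/-- The difference of the representation numbers of the two classes of discriminant `-15`, that is,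
the coefficients of the theta series of the genus character. -/
noncomputable def formDiff (n : ℕ) : ℤ := repCount principalForm n - repCount nonprincipalForm n

/-- Quadratic reciprocity for the discriminant `-15 = (-3) · 5`. -/
theorem legendreSym_neg_fifteen {p : ℕ} [Fact p.Prime] (hp2 : p ≠ 2) :
    legendreSym p (-15) = legendreSym 3 p * legendreSym 5 p := by
  have h5 := legendreSym.quadratic_reciprocity_one_mod_four (p := 5) (q := p) (by norm_num) hp2
  have h3 := legendreSym.quadratic_reciprocity' (p := 3) (q := p) (by norm_num) hp2
  have hodd : p % 2 = 1 := (Nat.Prime.eq_two_or_odd Fact.out).resolve_left hp2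
  rw [show (-15 : ℤ) = -1 * (3 : ℕ) * (5 : ℕ) by norm_num, legendreSym.mul, legendreSym.mul, h5, h3,
    legendreSym.at_neg_one hp2, ZMod.χ₄_eq_neg_one_pow hodd]
  have : ((-1 : ℤ) ^ (p / 2)) * (-1) ^ (p / 2) = 1 := by
    rw [← mul_pow]; norm_num
  rw [show 3 / 2 * (p / 2) = p / 2 by omega]
  linear_combination legendreSym 3 p * legendreSym 5 p * this

/-- Genus theory: the genus characters at the primes represented by the principal form. -/
theorem legendreSym_of_principalForm {p : ℕ} (hp : p.Prime) (hp3 : p ≠ 3) (hp5 : p ≠ 5) {X y : ℤ}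
    (h : principalForm X y = p) : legendreSym 3 p = 1 ∧ legendreSym 5 p = 1 := by
  have d3 : ∀ a b : ZMod 3, a ^ 2 + a * b + 4 * b ^ 2 = 0 ∨
      quadraticChar (ZMod 3) (a ^ 2 + a * b + 4 * b ^ 2) = 1 := by decide
  have d5 : ∀ a b : ZMod 5, a ^ 2 + a * b + 4 * b ^ 2 = 0 ∨
      quadraticChar (ZMod 5) (a ^ 2 + a * b + 4 * b ^ 2) = 1 := by decide
  have e3 := congrArg (Int.cast : ℤ → ZMod 3) h
  have e5 := congrArg (Int.cast : ℤ → ZMod 5) h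
  simp only [principalForm, Int.cast_add, Int.cast_mul, Int.cast_pow, Int.cast_ofNat] at e3 e5
  have d3 := d3 X y
  have d5 := d5 X y
  rw [e3, Int.cast_natCast, ZMod.natCast_eq_zero_iff, Nat.prime_dvd_prime_iff_eq Nat.prime_three hp]
    at d3
  rw [e5, Int.cast_natCast, ZMod.natCast_eq_zero_iff, Nat.prime_dvd_prime_iff_eq Nat.prime_five hp]
    at d5
  simp only [legendreSym, Int.cast_natCast]
  exact ⟨d3.resolve_left hp3.symm, d5.resolve_left hp5.symm⟩

/-- Genus theory: the genus characters at the primes represented by the other form. -/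
theorem legendreSym_of_nonprincipalForm {p : ℕ} (hp : p.Prime) (hp3 : p ≠ 3) (hp5 : p ≠ 5)
    {x y : ℤ} (h : nonprincipalForm x y = p) : legendreSym 3 p = -1 ∧ legendreSym 5 p = -1 := by
  have d3 : ∀ a b : ZMod 3, 2 * a ^ 2 + a * b + 2 * b ^ 2 = 0 ∨
      quadraticChar (ZMod 3) (2 * a ^ 2 + a * b + 2 * b ^ 2) = -1 := by decide
  have d5 : ∀ a b : ZMod 5, 2 * a ^ 2 + a * b + 2 * b ^ 2 = 0 ∨
      quadraticChar (ZMod 5) (2 * a ^ 2 + a * b + 2 * b ^ 2) = -1 := by decide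
  have e3 := congrArg (Int.cast : ℤ → ZMod 3) h
  have e5 := congrArg (Int.cast : ℤ → ZMod 5) h
  simp only [nonprincipalForm, Int.cast_add, Int.cast_mul, Int.cast_pow, Int.cast_ofNat] at e3 e5
  have d3 := d3 x y
  have d5 := d5 x y
  rw [e3, Int.cast_natCast, ZMod.natCast_eq_zero_iff, Nat.prime_dvd_prime_iff_eq Nat.prime_three hp]
    at d3
  rw [e5, Int.cast_natCast, ZMod.natCast_eq_zero_iff, Nat.prime_dvd_prime_iff_eq Nat.prime_five hp]
    at d5
  simp only [legendreSym, Int.cast_natCast]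
  exact ⟨d3.resolve_left hp3.symm, d5.resolve_left hp5.symm⟩

/-- The primes `p ≠ 3, 5` are unramified: the trace `2X + y` of `X + yω` satisfies
`(2X + y)² + 15 y² = 4 N(X + yω)`. -/
theorem not_dvd_trace {p : ℕ} (hp : p.Prime) (hp3 : p ≠ 3) (hp5 : p ≠ 5) {X y : ℤ}
    (h : (p : ℤ) ∣ principalForm X y) (hy : ¬ (p : ℤ) ∣ y) : ¬ (p : ℤ) ∣ 2 * X + y := by
  intro hd
  have hp' : Prime (p : ℤ) := Nat.prime_iff_prime_int.1 hp
  have h15 : (p : ℤ) ∣ 15 * y ^ 2 := by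
    have := dvd_sub (h.mul_left 4) (hd.mul_right (2 * X + y))
    rwa [show 4 * principalForm X y - (2 * X + y) * (2 * X + y) = 15 * y ^ 2 by
      unfold principalForm; ring] at this
  rcases hp'.dvd_or_dvd h15 with h' | h'
  · have : p ∣ 3 * 5 := by exact_mod_cast h'
    rcases hp.dvd_mul.1 this with h | h
    · exact hp3 ((Nat.prime_dvd_prime_iff_eq hp Nat.prime_three).1 h)
    · exact hp5 ((Nat.prime_dvd_prime_iff_eq hp Nat.prime_five).1 h)
  · exact hy (hp'.dvd_of_dvd_pow h')

/-- The coefficients `formDiff` are a Hecke eigenform whose eigenvalue at `p` is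
`χ₋₃(p) + χ₅(p)`, with nebentypus `χ₋₃ χ₅`. -/
theorem hecke_formDiff {p : ℕ} (hp : p.Prime) (n : ℕ) :
    hecke (legendreSym 3 p * legendreSym 5 p) p formDiff n =
      (legendreSym 3 p + legendreSym 5 p) * formDiff n := by
  have hp' : Prime (p : ℤ) := Nat.prime_iff_prime_int.1 hp
  rcases eq_or_ne p 2 with rfl | hp2
  · rw [show legendreSym 3 (2 : ℕ) = -1 by decide, show legendreSym 5 (2 : ℕ) = -1 by decide]
    have h1 := congrFun hecke_two_principalForm n
    have h2 := congrFun hecke_two_nonprincipalForm n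
    simp only [hecke, heckeTail, formDiff] at h1 h2 ⊢
    split_ifs at h1 h2 ⊢ <;> linarith
  rcases eq_or_ne p 3 with rfl | hp3
  · rw [show legendreSym 3 (3 : ℕ) = 0 by decide, show legendreSym 5 (3 : ℕ) = -1 by decide]
    refine hecke_sub_of_hecke_principalForm hp hp2 (ε := 0) (α := 0) (β := 1) ?_ n
    funext n
    rw [hecke, repCount_principalForm_of_dvd hp (X := 2 * 1) (y := -1) (by decide) (by decide),
      ncard_repsAbove_of_nonprincipalForm hp (by decide) (by decide)]
    ring
  rcases eq_or_ne p 5 with rfl | hp5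
  · rw [show legendreSym 3 (5 : ℕ) = -1 by decide, show legendreSym 5 (5 : ℕ) = 0 by decide]
    refine hecke_sub_of_hecke_principalForm hp hp2 (ε := 0) (α := 0) (β := 1) ?_ n
    funext n
    rw [hecke, repCount_principalForm_of_dvd hp (X := 2 * 1) (y := 1) (by decide) (by decide),
      ncard_repsAbove_of_nonprincipalForm hp (by decide) (by decide)]
    ring
  have hdvd2 : ¬ (p : ℤ) ∣ 2 := fun h =>
    hp2 ((Nat.prime_dvd_prime_iff_eq hp Nat.prime_two).1 (by exact_mod_cast h))
  by_cases hrep : ∃ X y w : ℤ, (w = 1 ∨ w = 2) ∧ principalForm X y = w * p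
  · obtain ⟨X, y, w, rfl | rfl, h⟩ := hrep
    · have hy := not_dvd_of_principalForm_eq hp' hp'.not_dvd_one h
      rw [one_mul] at h
      have hX : (p : ℤ) ∣ principalForm X y := h ▸ dvd_rfl
      obtain ⟨h3, h5⟩ := legendreSym_of_principalForm hp hp3 hp5 h
      rw [h3, h5]
      refine hecke_sub_of_hecke_principalForm hp hp2 (ε := 1) (α := 2) (β := 0) ?_ n
      funext n
      have := repCount_add_heckeTail_principalForm hp hX hy (not_dvd_trace hp hp3 hp5 hX hy) n
      rw [ncard_repsAbove_of_principalForm hp h hy] at this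
      rw [hecke]
      linarith
    · obtain ⟨x, y, h⟩ : ∃ x y : ℤ, nonprincipalForm x y = p := by
        rcases Int.even_or_odd' X with ⟨x, rfl | rfl⟩
        · exact ⟨x, y, by unfold principalForm at h; unfold nonprincipalForm; linarith⟩
        · rcases Int.even_or_odd' y with ⟨s, rfl | rfl⟩
          · unfold principalForm at h; ring_nf at h; omega
          · refine ⟨x + s + 1, -(2 * s + 1), ?_⟩
            unfold principalForm at h; unfold nonprincipalForm; linarith
      have h2 : principalForm (2 * x) y = 2 * p := by
        rw [← h]; unfold principalForm nonprincipalForm; ring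
      have hy := not_dvd_of_principalForm_eq hp' hdvd2 h2
      have hX : (p : ℤ) ∣ principalForm (2 * x) y := h2 ▸ dvd_mul_left _ _
      obtain ⟨h3, h5⟩ := legendreSym_of_nonprincipalForm hp hp3 hp5 h
      rw [h3, h5]
      refine hecke_sub_of_hecke_principalForm hp hp2 (ε := 1) (α := 0) (β := 2) ?_ n
      funext n
      have := repCount_add_heckeTail_principalForm hp hX hy (not_dvd_trace hp hp3 hp5 hX hy) n
      rw [ncard_repsAbove_of_nonprincipalForm hp h hy] at this
      rw [hecke]
      linarith
  · have hinert : ∀ a b : ℤ, (p : ℤ) ∣ principalForm a b → (p : ℤ) ∣ a ∧ (p : ℤ) ∣ b := fun a b h =>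
      (dvd_and_dvd_or_exists_principalForm_eq p hp hp2 a b h).resolve_right hrep
    have := Fact.mk hp
    have hne : ∀ q : ℕ, q.Prime → q ≠ p → ((p : ℤ) : ZMod q) ≠ 0 := fun q hq hqp h => by
      rw [Int.cast_natCast, ZMod.natCast_eq_zero_iff, Nat.prime_dvd_prime_iff_eq hq hp] at h
      exact hqp h
    have hprod : legendreSym 3 p * legendreSym 5 p ≠ 1 := by
      rw [← legendreSym_neg_fifteen hp2]
      intro h
      have h0 : ((-15 : ℤ) : ZMod p) ≠ 0 := fun h0 => by
        rw [(legendreSym.eq_zero_iff p (-15)).2 h0] at h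
        exact zero_ne_one h
      obtain ⟨s, hs⟩ := (legendreSym.eq_one_iff p h0).1 h
      -- `(s - 1) + 2ω` has norm `s² + 15`
      obtain ⟨s, rfl⟩ := ZMod.intCast_surjective s
      refine hdvd2 (hinert (s - 1) 2 ?_).2
      rw [← ZMod.intCast_zmod_eq_zero_iff_dvd]
      rw [show principalForm (s - 1) 2 = s * s - -15 by unfold principalForm; ring, Int.cast_sub,
        hs, Int.cast_mul, sub_self]
    have hval : legendreSym 3 p * legendreSym 5 p = -1 ∧ legendreSym 3 p + legendreSym 5 p = 0 := by
      rcases legendreSym.eq_one_or_neg_one 3 (hne 3 Nat.prime_three hp3.symm) with h3 | h3 <;>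
      rcases legendreSym.eq_one_or_neg_one 5 (hne 5 Nat.prime_five hp5.symm) with h5 | h5 <;>
      simp [h3, h5] at hprod ⊢
    rw [hval.1, hval.2]
    refine hecke_sub_of_hecke_principalForm hp hp2 (ε := -1) (α := 0) (β := 0) ?_ n
    funext n
    have h := ncard_smul_reps principalForm principalForm_mul hp.pos n
    have e : {z : ℤ × ℤ | principalForm z.1 z.2 = (p * n : ℕ) ∧ (p : ℤ) ∣ z.1 ∧ (p : ℤ) ∣ z.2} =
        {z | principalForm z.1 z.2 = (p * n : ℕ)} := by
      ext z
      simp only [Set.mem_ofPred_eq, and_iff_left_iff_imp]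
      exact fun h => hinert _ _ (h ▸ ⟨n, by push_cast; ring⟩)
    rw [e] at h
    rw [hecke, ← h, repCount]
    ring

/-- The Dirichlet convolution `χ₋₃ * χ₅`. -/
def genusConv (n : ℕ) : ℤ := ∑ x ∈ n.divisorsAntidiagonal, legendreSym 3 x.1 * legendreSym 5 x.2

theorem sum_divisorsAntidiagonal_filter_dvd {p : ℕ} (hp : 0 < p) (n : ℕ) (F : ℕ × ℕ → ℤ) :
    ∑ x ∈ (p * n).divisorsAntidiagonal with p ∣ x.1, F x =
      ∑ x ∈ n.divisorsAntidiagonal, F (p * x.1, x.2) := by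
  symm
  refine Finset.sum_bij (fun x _ => (p * x.1, x.2)) ?_ ?_ ?_ fun _ _ => rfl
  · rintro ⟨d, e⟩ h
    simp only [Finset.mem_filter, Nat.mem_divisorsAntidiagonal] at h ⊢
    obtain ⟨rfl, h⟩ := h
    exact ⟨⟨by ring, mul_ne_zero hp.ne' h⟩, dvd_mul_right _ _⟩
  · rintro ⟨d, e⟩ _ ⟨d', e'⟩ _ h
    simpa [hp.ne'] using h
  · rintro ⟨d, e⟩ h
    simp only [Finset.mem_filter, Nat.mem_divisorsAntidiagonal] at h
    obtain ⟨⟨h1, h2⟩, ⟨c, rfl⟩⟩ := h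
    refine ⟨(c, e), ?_, rfl⟩
    rw [Nat.mem_divisorsAntidiagonal]
    exact ⟨Nat.eq_of_mul_eq_mul_left hp (by rw [← h1]; ring), right_ne_zero_of_mul h2⟩

theorem sum_divisorsAntidiagonal_filter_not_dvd {p : ℕ} (hp : p.Prime) (n : ℕ) (F : ℕ × ℕ → ℤ) :
    ∑ x ∈ (p * n).divisorsAntidiagonal with ¬ p ∣ x.1, F x =
      ∑ x ∈ n.divisorsAntidiagonal with ¬ p ∣ x.1, F (x.1, p * x.2) := by
  symm
  refine Finset.sum_bij (fun x _ => (x.1, p * x.2)) ?_ ?_ ?_ fun _ _ => rfl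
  · rintro ⟨d, e⟩ h
    simp only [Finset.mem_filter, Nat.mem_divisorsAntidiagonal] at h ⊢
    obtain ⟨⟨rfl, h⟩, hd⟩ := h
    exact ⟨⟨by ring, mul_ne_zero hp.ne_zero h⟩, hd⟩
  · rintro ⟨d, e⟩ _ ⟨d', e'⟩ _ h
    simpa [hp.ne_zero] using h
  · rintro ⟨d, e⟩ h
    simp only [Finset.mem_filter, Nat.mem_divisorsAntidiagonal] at h
    obtain ⟨⟨h1, h2⟩, hd⟩ := h
    obtain ⟨c, rfl⟩ := (hp.dvd_mul.1 (h1 ▸ dvd_mul_right p n : p ∣ d * e)).resolve_left hd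
    refine ⟨(d, c), ?_, rfl⟩
    rw [Finset.mem_filter, Nat.mem_divisorsAntidiagonal]
    exact ⟨⟨Nat.eq_of_mul_eq_mul_left hp.pos (by rw [← h1]; ring), right_ne_zero_of_mul h2⟩, hd⟩

/-- Divisors `d` of `p n` are sorted by whether `p` divides `d`. -/
theorem hecke_genusConv {p : ℕ} (hp : p.Prime) (n : ℕ) :
    hecke (legendreSym 3 p * legendreSym 5 p) p genusConv n =
      (legendreSym 3 p + legendreSym 5 p) * genusConv n := by
  have hA : ∀ m, ∑ x ∈ (p * m).divisorsAntidiagonal with p ∣ x.1,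
      legendreSym 3 x.1 * legendreSym 5 x.2 = legendreSym 3 p * genusConv m := fun m => by
    rw [sum_divisorsAntidiagonal_filter_dvd hp.pos, genusConv, Finset.mul_sum]
    refine Finset.sum_congr rfl fun x _ => ?_
    rw [Nat.cast_mul, legendreSym.mul, mul_assoc]
  have hB : ∑ x ∈ (p * n).divisorsAntidiagonal with ¬ p ∣ x.1,
      legendreSym 3 x.1 * legendreSym 5 x.2 = legendreSym 5 p *
        ∑ x ∈ n.divisorsAntidiagonal with ¬ p ∣ x.1, legendreSym 3 x.1 * legendreSym 5 x.2 := by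
    rw [sum_divisorsAntidiagonal_filter_not_dvd hp, Finset.mul_sum]
    refine Finset.sum_congr rfl fun x _ => ?_
    rw [Nat.cast_mul, legendreSym.mul, mul_left_comm]
  have hC : ∑ x ∈ n.divisorsAntidiagonal with p ∣ x.1, legendreSym 3 x.1 * legendreSym 5 x.2 =
      legendreSym 3 p * heckeTail p genusConv n := by
    by_cases h : p ∣ n
    · obtain ⟨m, rfl⟩ := h
      rw [hA, heckeTail_mul p hp.pos]
    · rw [heckeTail, if_neg h, mul_zero]
      refine Finset.sum_eq_zero fun x hx => ?_
      rw [Finset.mem_filter, Nat.mem_divisorsAntidiagonal] at hx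
      exact absurd (hx.2.trans ⟨_, hx.1.1.symm⟩) h
  have h1 := Finset.sum_filter_add_sum_filter_not (p * n).divisorsAntidiagonal (fun x => p ∣ x.1)
    fun x => legendreSym 3 x.1 * legendreSym 5 x.2
  have h2 := Finset.sum_filter_add_sum_filter_not n.divisorsAntidiagonal (fun x => p ∣ x.1)
    fun x => legendreSym 3 x.1 * legendreSym 5 x.2
  rw [hA, hB] at h1
  rw [hC] at h2
  rw [hecke]
  simp only [genusConv] at *
  linear_combination -h1 + legendreSym 5 p * h2

/-- Both sides are Hecke eigenforms with the same eigenvalues. -/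
theorem formDiff_eq_genusConv (n : ℕ) : formDiff n = 2 * genusConv n := by
  induction n using Nat.strong_induction_on with
  | _ n IH =>
  rcases Nat.lt_or_ge n 2 with hn | hn
  · interval_cases n
    · -- the Hecke relation at `2` forces the constant term to vanish
      have h := hecke_formDiff Nat.prime_two 0
      rw [show legendreSym 3 (2 : ℕ) = -1 by decide, show legendreSym 5 (2 : ℕ) = -1 by decide] at h
      simp only [hecke, heckeTail, dvd_zero, if_true, mul_zero, Nat.zero_div] at h
      simp only [genusConv, Nat.divisorsAntidiagonal_zero, Finset.sum_empty]
      linarith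
    · have h1 : {z : ℤ × ℤ | principalForm z.1 z.2 = ((1 : ℕ) : ℤ)} = {(1, 0), (-1, 0)} := by
        ext ⟨a, b⟩
        simp only [Set.mem_ofPred_eq, Set.mem_insert_iff, Set.mem_singleton_iff, Prod.mk.injEq]
        constructor
        · intro h
          have h' := sq_add_sq_le_principalForm a b
          rw [h, Nat.cast_one] at h'
          have : a ≤ 1 := by nlinarith [sq_nonneg b]
          have : -1 ≤ a := by nlinarith [sq_nonneg b]
          have : b ≤ 1 := by nlinarith [sq_nonneg a]
          have : -1 ≤ b := by nlinarith [sq_nonneg a]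
          interval_cases a <;> interval_cases b <;> simp_all [principalForm]
        · rintro (⟨rfl, rfl⟩ | ⟨rfl, rfl⟩) <;> rfl
      have h2 : {z : ℤ × ℤ | nonprincipalForm z.1 z.2 = ((1 : ℕ) : ℤ)} = ∅ := by
        refine Set.eq_empty_iff_forall_notMem.2 ?_
        rintro ⟨a, b⟩ h
        simp only [Set.mem_ofPred_eq] at h
        have h' := sq_add_sq_le_nonprincipalForm a b
        rw [h, Nat.cast_one] at h'
        have : a ≤ 1 := by nlinarith [sq_nonneg b]
        have : -1 ≤ a := by nlinarith [sq_nonneg b]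
        have : b ≤ 1 := by nlinarith [sq_nonneg a]
        have : -1 ≤ b := by nlinarith [sq_nonneg a]
        interval_cases a <;> interval_cases b <;> simp_all [nonprincipalForm]
      rw [formDiff, repCount, repCount, h1, h2, Set.ncard_empty, Set.ncard_pair (by decide)]
      decide
  · obtain ⟨p, hp, m, rfl⟩ := Nat.exists_prime_and_dvd (n := n) (by omega)
    have hm : 0 < m := by
      rcases Nat.eq_zero_or_pos m with rfl | h
      · omega
      · exact h
    have hlt : m < p * m := (Nat.lt_mul_iff_one_lt_left hm).2 hp.one_lt
    have hf := hecke_formDiff hp m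
    have hg := hecke_genusConv hp m
    have htail : heckeTail p formDiff m = 2 * heckeTail p genusConv m := by
      unfold heckeTail
      split_ifs
      · exact IH _ ((Nat.div_le_self m p).trans_lt hlt)
      · rfl
    simp only [hecke] at hf hg
    rw [IH m hlt, htail] at hf
    linarith

/-! ### Discriminant `-60` and lattice sums -/

/-- The form `m² + 15k²`, of discriminant `-60`. -/
def principalForm₆₀ (m k : ℤ) : ℤ := m ^ 2 + 15 * k ^ 2

/-- The form `3m² + 5k²`, of discriminant `-60`. -/
def nonprincipalForm₆₀ (m k : ℤ) : ℤ := 3 * m ^ 2 + 5 * k ^ 2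

theorem sq_add_sq_le_principalForm₆₀ (m k : ℤ) : m ^ 2 + k ^ 2 ≤ 2 * principalForm₆₀ m k := by
  unfold principalForm₆₀; nlinarith [sq_nonneg m, sq_nonneg k]

theorem sq_add_sq_le_nonprincipalForm₆₀ (m k : ℤ) :
    m ^ 2 + k ^ 2 ≤ 2 * nonprincipalForm₆₀ m k := by
  unfold nonprincipalForm₆₀; nlinarith [sq_nonneg m, sq_nonneg k]

/-- The order of discriminant `-60` is the sublattice of `ℤ[ω]` with even `ω`-coordinate. -/
theorem repCount_principalForm₆₀ (n : ℕ) : repCount principalForm₆₀ n =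
    ({z : ℤ × ℤ | principalForm z.1 z.2 = n ∧ 2 ∣ z.2}.ncard : ℤ) := by
  unfold repCount
  congr 1
  refine Set.ncard_congr (fun z _ => (z.1 - z.2, 2 * z.2)) ?_ ?_ ?_
  · rintro ⟨u, v⟩ hz
    simp only [Set.mem_ofPred_eq] at hz ⊢
    refine ⟨?_, by simp⟩
    rw [← hz]; unfold principalForm principalForm₆₀; ring
  · rintro ⟨u, v⟩ ⟨u', v'⟩ _ _ e
    simp only [Prod.mk.injEq] at e ⊢
    omega
  · rintro ⟨a, b⟩ ⟨hz, v, hv⟩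
    simp only at hz hv
    subst hv
    refine ⟨(a + v, v), ?_, by simp⟩
    simp only [Set.mem_ofPred_eq]
    rw [← hz]; unfold principalForm principalForm₆₀; ring

/-- Here `m = k' + m'`, `k = k' - m'` turns `2m² + mk + 2k²` into `3m'² + 5k'²`. -/
theorem repCount_nonprincipalForm₆₀ (n : ℕ) : repCount nonprincipalForm₆₀ n =
    ({z : ℤ × ℤ | nonprincipalForm z.1 z.2 = n ∧ 2 ∣ z.1 - z.2}.ncard : ℤ) := by
  unfold repCount
  congr 1
  refine Set.ncard_congr (fun z _ => (z.2 + z.1, z.2 - z.1)) ?_ ?_ ?_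
  · rintro ⟨u, v⟩ hz
    simp only [Set.mem_ofPred_eq] at hz ⊢
    refine ⟨?_, u, by ring⟩
    rw [← hz]; unfold nonprincipalForm nonprincipalForm₆₀; ring
  · rintro ⟨u, v⟩ ⟨u', v'⟩ _ _ e
    simp only [Prod.mk.injEq] at e ⊢
    omega
  · rintro ⟨a, b⟩ ⟨hz, v, hv⟩
    simp only at hz hv
    obtain rfl : a = b + 2 * v := by linarith
    refine ⟨(v, b + v), ?_, by ext <;> simp; ring⟩
    simp only [Set.mem_ofPred_eq]
    rw [← hz]; unfold nonprincipalForm nonprincipalForm₆₀; ring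

theorem repCount_principalForm₆₀_odd (n : ℕ) :
    repCount principalForm₆₀ (2 * n + 1) = repCount principalForm (2 * n + 1) := by
  rw [repCount_principalForm₆₀, repCount]
  congr 2
  ext ⟨a, b⟩
  simp only [Set.mem_ofPred_eq, and_iff_left_iff_imp]
  intro h
  by_contra hb
  obtain ⟨s, rfl⟩ := Int.not_even_iff_odd.1 fun h => hb (even_iff_two_dvd.1 h)
  unfold principalForm at h
  push_cast at h
  rcases Int.even_or_odd' a with ⟨t, rfl | rfl⟩ <;> ring_nf at h <;> omega

theorem repCount_principalForm₆₀_even (n : ℕ) :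
    repCount principalForm₆₀ (2 * n) = heckeTail 2 (repCount principalForm) n := by
  rw [repCount_principalForm₆₀, ← ncard_smul_reps principalForm principalForm_mul two_pos n]
  congr 2
  ext ⟨a, b⟩
  simp only [Set.mem_ofPred_eq, Nat.cast_ofNat, and_congr_right_iff, iff_and_self]
  rintro h ⟨s, rfl⟩
  refine Int.prime_two.dvd_of_dvd_pow (n := 2) ⟨n - a * s - 8 * s ^ 2, ?_⟩
  unfold principalForm at h
  push_cast at h
  linarith

theorem repCount_nonprincipalForm₆₀_odd (n : ℕ) :
    repCount nonprincipalForm₆₀ (2 * n + 1) = repCount nonprincipalForm (2 * n + 1) := by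
  rw [repCount_nonprincipalForm₆₀, repCount]
  congr 2
  ext ⟨a, b⟩
  simp only [Set.mem_ofPred_eq, and_iff_left_iff_imp]
  intro h
  unfold nonprincipalForm at h
  push_cast at h
  rcases Int.even_or_odd' a with ⟨t, rfl | rfl⟩ <;>
  rcases Int.even_or_odd' b with ⟨s, rfl | rfl⟩ <;> ring_nf at h <;> omega

theorem repCount_nonprincipalForm₆₀_even (n : ℕ) :
    repCount nonprincipalForm₆₀ (2 * n) = heckeTail 2 (repCount nonprincipalForm) n := by
  rw [repCount_nonprincipalForm₆₀,
    ← ncard_smul_reps nonprincipalForm nonprincipalForm_mul two_pos n]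
  congr 2
  ext ⟨a, b⟩
  simp only [Set.mem_ofPred_eq, Nat.cast_ofNat, and_congr_right_iff]
  intro h
  have : 2 ∣ a * b := ⟨n - a ^ 2 - b ^ 2, by unfold nonprincipalForm at h; push_cast at h; linarith⟩
  have := Int.prime_two.dvd_or_dvd this
  omega

/-- The coefficients of the double series, in terms of the forms of discriminant `-15`. -/
theorem repCount_combination (n : ℕ) :
    repCount principalForm₆₀ n - repCount nonprincipalForm₆₀ n + repCount nonprincipalForm n
      - repCount principalForm n = heckeTail 2 (fun m => 2 * formDiff m + 2 * heckeTail 2 formDiff m)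
        n := by
  rcases Nat.even_or_odd' n with ⟨m, rfl | rfl⟩
  · rw [heckeTail_mul 2 two_pos, repCount_principalForm₆₀_even, repCount_nonprincipalForm₆₀_even]
    have h := hecke_formDiff Nat.prime_two m
    rw [show legendreSym 3 (2 : ℕ) = -1 by decide, show legendreSym 5 (2 : ℕ) = -1 by decide] at h
    simp only [hecke, heckeTail, formDiff] at h ⊢
    split_ifs at h ⊢ <;> linarith
  · rw [repCount_principalForm₆₀_odd, repCount_nonprincipalForm₆₀_odd, heckeTail, if_neg (by omega)]
    ring

/-- In terms of Dirichlet series, `heckeTail p` is multiplication by `p⁻ˢ`, here at `s = 2`. -/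
theorem hasSum_heckeTail {p : ℕ} (hp : 0 < p) {r : ℕ → ℤ} {s : ℝ}
    (h : HasSum (fun n : ℕ => (r n : ℝ) / (n : ℝ) ^ 2) s) :
    HasSum (fun n : ℕ => (heckeTail p r n : ℝ) / (n : ℝ) ^ 2) (s / (p : ℝ) ^ 2) := by
  have hinj : Function.Injective fun n : ℕ => p * n := fun a b e => Nat.eq_of_mul_eq_mul_left hp e
  rw [← hinj.hasSum_iff]
  · refine HasSum.congr_fun (h.div_const ((p : ℝ) ^ 2)) fun n => ?_
    simp only [Function.comp_apply, heckeTail_mul p hp]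
    push_cast
    rw [mul_pow, div_div, mul_comm]
  · intro n hn
    have : ¬ p ∣ n := fun ⟨m, hm⟩ => hn ⟨m, hm.symm⟩
    simp [heckeTail, this]

/-- At the origin, and wherever else `P` vanishes, the summand is `1 / 0 = 0`. -/
theorem summable_one_div_form_sq {P : ℤ → ℤ → ℤ} (hP : ∀ m k, m ^ 2 + k ^ 2 ≤ 2 * P m k) :
    Summable fun z : ℤ × ℤ => 1 / (P z.1 z.2 : ℝ) ^ 2 := by
  rw [← (finTwoArrowEquiv ℤ).summable_iff]
  refine Summable.of_norm_bounded_eventually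
    ((EisensteinSeries.summable_one_div_norm_rpow (k := 4) (by norm_num)).mul_left 4) ?_
  filter_upwards [(Set.finite_singleton (0 : Fin 2 → ℤ)).compl_mem_cofinite] with x hx
  have hx0 : 0 < ‖x‖ := norm_pos_iff.2 hx
  have hnorm : ‖x‖ ^ 2 ≤ 2 * (P (x 0) (x 1) : ℝ) := by
    have h : ((x 0 : ℝ)) ^ 2 + (x 1 : ℝ) ^ 2 ≤ 2 * (P (x 0) (x 1) : ℝ) := by
      exact_mod_cast hP (x 0) (x 1)
    refine le_trans ?_ h
    rw [EisensteinSeries.norm_eq_max_natAbs]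
    rcases max_choice (x 0).natAbs (x 1).natAbs with h' | h' <;>
    rw [h', Nat.cast_natAbs, Int.cast_abs, sq_abs] <;> nlinarith [sq_nonneg (x 0 : ℝ)]
  have hP0 : 0 < (P (x 0) (x 1) : ℝ) := by nlinarith [sq_pos_of_pos hx0]
  change ‖1 / (P (x 0) (x 1) : ℝ) ^ 2‖ ≤ _
  rw [Real.norm_of_nonneg (by positivity), Real.rpow_neg hx0.le,
    show (4 : ℝ) = ((4 : ℕ) : ℝ) by norm_num, Real.rpow_natCast, ← div_eq_mul_inv,
    div_le_div_iff₀ (by positivity) (by positivity)]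
  push_cast
  nlinarith [pow_le_pow_left₀ (by positivity) hnorm 2]

/-- Grouping the lattice points by the value of the form. -/
theorem hasSum_repCount {P : ℤ → ℤ → ℤ} (hP : ∀ m k, m ^ 2 + k ^ 2 ≤ 2 * P m k) :
    HasSum (fun n : ℕ => (repCount P n : ℝ) / (n : ℝ) ^ 2)
      (∑' z : ℤ × ℤ, 1 / (P z.1 z.2 : ℝ) ^ 2) := by
  have hnn : ∀ z : ℤ × ℤ, 0 ≤ P z.1 z.2 := fun z => by
    nlinarith [hP z.1 z.2, sq_nonneg z.1, sq_nonneg z.2]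
  refine HasSum.congr_fun
    ((summable_one_div_form_sq hP).hasSum.tsum_fiberwise fun z => (P z.1 z.2).toNat) fun n => ?_
  have hset : (fun z : ℤ × ℤ => (P z.1 z.2).toNat) ⁻¹' {n} = {z | P z.1 z.2 = n} := by
    ext z
    have := hnn z
    simp only [Set.mem_preimage, Set.mem_singleton_iff, Set.mem_ofPred_eq]
    omega
  rw [hset]
  have hc : ∀ z : {z : ℤ × ℤ | P z.1 z.2 = n}, 1 / (P z.1.1 z.1.2 : ℝ) ^ 2 = 1 / (n : ℝ) ^ 2 := by
    rintro ⟨z, hz⟩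
    simp only [Set.mem_ofPred_eq] at hz
    simp [hz]
  rw [tsum_congr hc, tsum_const, repCount, nsmul_eq_mul, mul_one_div, Int.cast_natCast,
    Nat.card_coe_set_eq]

/-! ### Values at `2` -/

theorem cos_two_pi_div_five : Real.cos (2 * Real.pi / 5) = (Real.sqrt 5 - 1) / 4 := by
  rw [show 2 * Real.pi / 5 = 2 * (Real.pi / 5) by ring, Real.cos_two_mul, Real.cos_pi_div_five]
  have := Real.sq_sqrt (show (0 : ℝ) ≤ 5 by norm_num)
  linear_combination this / 8

theorem cos_four_pi_div_five : Real.cos (4 * Real.pi / 5) = -(1 + Real.sqrt 5) / 4 := by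
  rw [show 4 * Real.pi / 5 = Real.pi - Real.pi / 5 by ring, Real.cos_pi_sub, Real.cos_pi_div_five]
  ring

/-- The Fourier expansion (Gauss sum) of the quadratic character modulo `5`. -/
theorem cos_sub_cos_eq_legendreSym (n : ℕ) :
    Real.cos (2 * Real.pi * n * (1 / 5)) - Real.cos (2 * Real.pi * n * (2 / 5)) =
      Real.sqrt 5 / 2 * legendreSym 5 n := by
  obtain ⟨q, r, hr, rfl⟩ : ∃ q r : ℕ, r < 5 ∧ n = r + 5 * q :=
    ⟨n / 5, n % 5, Nat.mod_lt _ (by norm_num), (Nat.mod_add_div n 5).symm⟩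
  have h1 : legendreSym 5 ((r + 5 * q : ℕ) : ℤ) = legendreSym 5 r := by
    rw [legendreSym.mod]; conv_rhs => rw [legendreSym.mod]
    congr 1; push_cast; omega
  have h2 : Real.cos (2 * Real.pi * (r + 5 * q : ℕ) * (1 / 5)) =
      Real.cos (2 * Real.pi * r / 5) := by
    rw [← Real.cos_add_nat_mul_two_pi (2 * Real.pi * r / 5) q]; congr 1; push_cast; ring
  have h3 : Real.cos (2 * Real.pi * (r + 5 * q : ℕ) * (2 / 5)) =
      Real.cos (4 * Real.pi * r / 5) := by
    rw [← Real.cos_add_nat_mul_two_pi (4 * Real.pi * r / 5) (2 * q)]; congr 1; push_cast; ring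
  rw [h1, h2, h3]
  have c1 := cos_two_pi_div_five
  have c2 := cos_four_pi_div_five
  interval_cases r
  · rw [show legendreSym 5 (0 : ℕ) = 0 by decide]; simp
  · rw [show legendreSym 5 (1 : ℕ) = 1 by decide]
    simp only [Nat.cast_one, mul_one]
    rw [c1, c2]; push_cast; ring
  · rw [show legendreSym 5 (2 : ℕ) = -1 by decide,
      show 2 * Real.pi * (2 : ℕ) / 5 = 4 * Real.pi / 5 by push_cast; ring,
      show 4 * Real.pi * (2 : ℕ) / 5 = 2 * Real.pi - 2 * Real.pi / 5 by push_cast; ring,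
      Real.cos_two_pi_sub, c1, c2]
    push_cast; ring
  · rw [show legendreSym 5 (3 : ℕ) = -1 by decide,
      show 2 * Real.pi * (3 : ℕ) / 5 = 2 * Real.pi - 4 * Real.pi / 5 by push_cast; ring,
      show 4 * Real.pi * (3 : ℕ) / 5 = 2 * Real.pi / 5 + 2 * Real.pi by push_cast; ring,
      Real.cos_two_pi_sub, Real.cos_add_two_pi, c1, c2]
    push_cast; ring
  · rw [show legendreSym 5 (4 : ℕ) = 1 by decide,
      show 2 * Real.pi * (4 : ℕ) / 5 = 2 * Real.pi - 2 * Real.pi / 5 by push_cast; ring,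
      show 4 * Real.pi * (4 : ℕ) / 5 = 2 * Real.pi - 4 * Real.pi / 5 + 2 * Real.pi by
        push_cast; ring,
      Real.cos_add_two_pi, Real.cos_two_pi_sub, Real.cos_two_pi_sub, c1, c2]
    push_cast; ring

/-- The value `L(χ₅, 2) = 4π² / (25√5)`. -/
theorem hasSum_legendreSym_five :
    HasSum (fun n : ℕ => (legendreSym 5 n : ℝ) / (n : ℝ) ^ 2)
      (4 * Real.pi ^ 2 / (25 * Real.sqrt 5)) := by
  have h1 := hasSum_one_div_nat_pow_mul_cos one_ne_zero (x := 1 / 5) ⟨by norm_num, by norm_num⟩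
  have h2 := hasSum_one_div_nat_pow_mul_cos one_ne_zero (x := 2 / 5) ⟨by norm_num, by norm_num⟩
  have h5 : Real.sqrt 5 ≠ 0 := by positivity
  have h := (h1.sub h2).mul_left (2 / Real.sqrt 5)
  rw [show ∀ x : ℝ, Polynomial.eval x (Polynomial.map (algebraMap ℚ ℝ)
    (Polynomial.bernoulli (2 * 1))) = x ^ 2 - x + 6⁻¹ from bernoulliFun_two,
    show ∀ x : ℝ, Polynomial.eval x (Polynomial.map (algebraMap ℚ ℝ)
    (Polynomial.bernoulli (2 * 1))) = x ^ 2 - x + 6⁻¹ from bernoulliFun_two] at h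
  rw [show 4 * Real.pi ^ 2 / (25 * Real.sqrt 5) = 2 / Real.sqrt 5 *
      ((-1) ^ (1 + 1) * (2 * Real.pi) ^ (2 * 1) / 2 / (2 * 1).factorial * ((1 / 5) ^ 2 - 1 / 5 + 6⁻¹)
        - (-1) ^ (1 + 1) * (2 * Real.pi) ^ (2 * 1) / 2 / (2 * 1).factorial *
          ((2 / 5) ^ 2 - 2 / 5 + 6⁻¹)) by
    norm_num [Nat.factorial]; field_simp; ring]
  refine h.congr_fun fun n => ?_
  rw [← mul_sub, cos_sub_cos_eq_legendreSym, mul_one]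
  field_simp

/-- The theta coefficients have the Dirichlet series `2 L(χ₋₃, s) L(χ₅, s)`, here at `s = 2`. -/
theorem hasSum_formDiff :
    HasSum (fun n : ℕ => (formDiff n : ℂ) / (n : ℂ) ^ 2)
      (2 * (LSeries (fun n : ℕ => chiNegThree (n : ZMod 3)) 2 *
        (4 * Real.pi ^ 2 / (25 * Real.sqrt 5) : ℝ))) := by
  have h3 : LSeriesHasSum (fun n : ℕ => chiNegThree (n : ZMod 3)) 2
      (LSeries (fun n : ℕ => chiNegThree (n : ZMod 3)) 2) :=
    (chiNegThree.LSeriesSummable_of_one_lt_re (by norm_num)).LSeriesHasSum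
  have h5 : LSeriesHasSum (fun n : ℕ => (legendreSym 5 n : ℂ)) 2
      ((4 * Real.pi ^ 2 / (25 * Real.sqrt 5) : ℝ) : ℂ) := by
    refine HasSum.congr_fun (Complex.hasSum_ofReal.2 hasSum_legendreSym_five) fun n => ?_
    rw [LSeries.term_def]
    split_ifs with hn
    · simp [hn]
    · push_cast
      rw [show (2 : ℂ) = ((2 : ℕ) : ℂ) by norm_num, Complex.cpow_natCast]
  refine HasSum.congr_fun ((h3.convolution h5).mul_left 2) fun n => ?_
  rw [LSeries.term_def]
  split_ifs with hn
  · simp [hn]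
  · rw [show (2 : ℂ) = ((2 : ℕ) : ℂ) by norm_num, Complex.cpow_natCast, LSeries.convolution_def,
      formDiff_eq_genusConv, genusConv]
    push_cast
    rw [mul_div_assoc]
    rfl

theorem proposition3 :
    Summable (fun p : {p : ℤ × ℤ // p ≠ (0, 0)} => dirichletTerm p.1.1 p.1.2) ∧
    ((6 * Real.sqrt 15 / Real.pi ^ 3 *
        ∑' p : {p : ℤ × ℤ // p ≠ (0, 0)}, dirichletTerm p.1.1 p.1.2 : ℝ) : ℂ)
      = 8 / 5 * dThree := by
  have hterm : (fun z : ℤ × ℤ => dirichletTerm z.1 z.2) = fun z : ℤ × ℤ =>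
      1 / (principalForm₆₀ z.1 z.2 : ℝ) ^ 2 - 1 / (nonprincipalForm₆₀ z.1 z.2 : ℝ) ^ 2
        + 1 / (nonprincipalForm z.1 z.2 : ℝ) ^ 2 - 1 / (principalForm z.1 z.2 : ℝ) ^ 2 := by
    funext z
    simp only [dirichletTerm, principalForm, nonprincipalForm, principalForm₆₀, nonprincipalForm₆₀]
    push_cast
    rfl
  have s1 := summable_one_div_form_sq sq_add_sq_le_principalForm₆₀
  have s2 := summable_one_div_form_sq sq_add_sq_le_nonprincipalForm₆₀
  have s3 := summable_one_div_form_sq sq_add_sq_le_nonprincipalForm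
  have s4 := summable_one_div_form_sq sq_add_sq_le_principalForm
  have hsum := ((s1.hasSum.sub s2.hasSum).add s3.hasSum).sub s4.hasSum
  rw [← hterm] at hsum
  have hF := (hasSum_repCount sq_add_sq_le_principalForm).sub
    (hasSum_repCount sq_add_sq_le_nonprincipalForm)
  set F := (∑' z : ℤ × ℤ, 1 / (principalForm z.1 z.2 : ℝ) ^ 2) -
    ∑' z : ℤ × ℤ, 1 / (nonprincipalForm z.1 z.2 : ℝ) ^ 2
  have hF : HasSum (fun n : ℕ => (formDiff n : ℝ) / (n : ℝ) ^ 2) F := by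
    refine HasSum.congr_fun hF fun n => ?_
    rw [formDiff]; push_cast; ring
  have hcount := (((hasSum_repCount sq_add_sq_le_principalForm₆₀).sub
    (hasSum_repCount sq_add_sq_le_nonprincipalForm₆₀)).add
    (hasSum_repCount sq_add_sq_le_nonprincipalForm)).sub
    (hasSum_repCount sq_add_sq_le_principalForm)
  have hcomb : HasSum (fun n : ℕ =>
      (heckeTail 2 (fun m => 2 * formDiff m + 2 * heckeTail 2 formDiff m) n : ℝ) / (n : ℝ) ^ 2)
      ((2 * F + 2 * (F / (2 : ℕ) ^ 2)) / (2 : ℕ) ^ 2) := by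
    refine hasSum_heckeTail two_pos ?_
    refine HasSum.congr_fun ((hF.mul_left 2).add ((hasSum_heckeTail two_pos hF).mul_left 2))
      fun n => ?_
    push_cast; ring
  have heq := hcount.unique (hcomb.congr_fun fun n => by
    rw [← repCount_combination n]; push_cast; ring)
  rw [heq] at hsum
  have hFval : (F : ℂ) = 2 * (LSeries (fun n : ℕ => chiNegThree (n : ZMod 3)) 2 *
      (4 * Real.pi ^ 2 / (25 * Real.sqrt 5) : ℝ)) := by
    refine HasSum.unique ?_ hasSum_formDiff
    refine HasSum.congr_fun (Complex.hasSum_ofReal.2 hF) fun n => ?_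
    push_cast; rfl
  -- the term at the origin is `0` because `1 / 0 = 0`
  have hsupp : Function.support (fun z : ℤ × ℤ => dirichletTerm z.1 z.2) ⊆
      {p : ℤ × ℤ | p ≠ (0, 0)} := by
    rintro z hz rfl
    exact hz (by simp [dirichletTerm])
  have hsub := (hasSum_subtype_iff_of_support_subset hsupp).2 hsum
  refine ⟨hsub.summable, ?_⟩
  have htsum : ∑' p : {p : ℤ × ℤ // p ≠ (0, 0)}, dirichletTerm p.1.1 p.1.2 = 5 / 8 * F := by
    rw [show 5 / 8 * F = (2 * F + 2 * (F / (2 : ℕ) ^ 2)) / (2 : ℕ) ^ 2 by push_cast; ring]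
    exact hsub.tsum_eq
  have h15 : Real.sqrt 15 = Real.sqrt 3 * Real.sqrt 5 := by
    rw [← Real.sqrt_mul (by norm_num)]; norm_num
  rw [htsum, dThree]
  push_cast
  rw [hFval, h15]
  push_cast
  have hpi : (Real.pi : ℂ) ≠ 0 := by exact_mod_cast Real.pi_ne_zero
  have h5 : ((Real.sqrt 5 : ℝ) : ℂ) ≠ 0 := by
    exact_mod_cast (Real.sqrt_pos.2 (by norm_num : (0 : ℝ) < 5)).ne'
  field_simp
  ring
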